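/- Let $K$ be a field of characteristic different from $2$, and for nonzero elements $a,b$ of a field $F$ let $(a,b)$ denote the quaternion $F$-algebra with basis $1,i,j,ij$ and relations $i^2=a$, $j^2=b$, $ij=-ji$, as well as its class in $\mathrm{Br}(F)$. Let $q$ be a nondegenerate quadratic form of rank $6$ over $K$ whose signed discriminant $\Delta=-\det(M)$, where $M$ is the Gram symmetric matrix of $q$ in some basis, is not a square in $K$, and let $L=K(\sqrt{\Delta})$ be its discriminant extension. Then the center of the even Clifford algebra $C_0(q)$ is $K$-isomorphic to $L$. For every identification of the center with $L$ over $K$, $C_0(q)$ is a central simple $L$-algebra. Its class $c_0(q)\in\mathrm{Br}(L)$ satisfies the following. (a) If $q\cong\langle a_1,\dots,a_6\rangle$ with $a_1,\dots,a_6\in K$, then $$c_0(q)=(-a_1a_2,\,-a_1a_3)\otimes(a_1a_2a_3a_4,\,a_1a_2a_3a_5)\quad\text{in }\mathrm{Br}(L).$$ (b) Let $m_i$ be the determinant of the leading principal $i\times i$ submatrix of the Gram symmetric matrix of $q$ with respect to a given basis. If $m_1,\dots,m_5$ are nonzero, then $$c_0(q)=(-m_2,\,-m_1m_3)\otimes(m_4,\,-m_3m_5)\quad\text{in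 }\mathrm{Br}(L).$$ -/

import Mathlib

universe u

open scoped TensorProduct Quaternion

noncomputable section

/-- The signed discriminant `(-1)^(n(n-1)/2) * det M` of a quadratic form on an `n`-dimensional
space, where `M` is its Gram symmetric matrix with respect to the basis `b`.  (A change of basis
multiplies it by a nonzero square.)  For `n = 6` it is `-det M`. -/
def signedDiscriminant {K V : Type*} [Field K] [Invertible (2 : K)] [AddCommGroup V] [Module K V]
    {n : ℕ} (b : Module.Basis (Fin n) K V) (q : QuadraticForm K V) : K :=
  (-1) ^ (n * (n - 1) / 2) * QuadraticForm.discr b q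

/-- `L` is the discriminant extension `K(√Δ)` of `q`, and it is nontrivial, i.e. the signed
discriminant `Δ` of `q` is not a square in `K`. -/
structure IsNontrivialDiscriminantExtension {K V : Type*} (L : Type*) [Field K]
    [Invertible (2 : K)] [AddCommGroup V] [Module K V] [Field L] [Algebra K L]
    {n : ℕ} (b : Module.Basis (Fin n) K V) (q : QuadraticForm K V) : Prop where
  not_isSquare : ¬ IsSquare (signedDiscriminant b q)
  exists_sqrt : ∃ δ : L, δ ^ 2 = algebraMap K L (signedDiscriminant b q) ∧
    IntermediateField.adjoin K {δ} = ⊤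

/-- The determinant of the leading principal `i × i` submatrix of an `n × n` matrix. -/
def leadingPrincipalMinor {K : Type*} [CommRing K] {n : ℕ} (M : Matrix (Fin n) (Fin n) K)
    (i : ℕ) (hi : i ≤ n) : K :=
  (M.submatrix (Fin.castLE hi) (Fin.castLE hi)).det

section EvenClifford

variable {K L V : Type*} [Field K] [Field L] [Algebra K L] [AddCommGroup V] [Module K V]
  {q : QuadraticForm K V}

/-- The even Clifford algebra `C₀(q)`, to be regarded as an algebra over `L` by means of an
identification `φ` over `K` of `L` with the center of `C₀(q)`. -/
def EvenCliffordOver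
    (_φ : L ≃ₐ[K] Subalgebra.center K (CliffordAlgebra.even q)) : Type _ :=
  CliffordAlgebra.even q

instance EvenCliffordOver.instRing
    (φ : L ≃ₐ[K] Subalgebra.center K (CliffordAlgebra.even q)) : Ring (EvenCliffordOver φ) :=
  inferInstanceAs (Ring (CliffordAlgebra.even q))

/-- The scalar `x : L` acts on `C₀(q)` as multiplication by the central element `φ x`. -/
instance EvenCliffordOver.instAlgebra
    (φ : L ≃ₐ[K] Subalgebra.center K (CliffordAlgebra.even q)) :
    Algebra L (EvenCliffordOver φ) :=
  RingHom.toAlgebra' (S := CliffordAlgebra.even q)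
    (((Subalgebra.center K (CliffordAlgebra.even q)).val.comp φ.toAlgHom).toRingHom)
    (fun x y => ((Subalgebra.mem_center_iff.mp (φ x).2) y).symm)

end EvenClifford

/-- The `F`-algebra `A` is a finite-dimensional central simple algebra, and `β` is its class in
the Brauer group of `F`. -/
def HasBrauerClass (F A : Type u) [Field F] [Ring A] [Algebra F A]
    (β : BrauerGroup.{u, u} F) : Prop :=
  ∃ B : CSA.{u, u} F, Nonempty (A ≃ₐ[F] B) ∧ Quotient.mk (Brauer.CSA_Setoid F) B = β

/-- For a quadratic form `q` over `K` and an extension `L` of `K`: the center of the even Clifford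
algebra `C₀(q)` is isomorphic to `L` over `K` and, however it is identified with `L`, `C₀(q)` is a
central simple algebra over `L` whose class in `Br(L)` is `(α, β) ⊗ (γ, δ)`, the class of the
tensor product of two quaternion algebras.  Here `ℍ[L, α, β]` is the algebra with `L`-basis
`1, i, j, ij`, where `i² = α`, `j² = β`, `ij = -ji`. -/
def EvenCliffordClassEq {K V L : Type u} [Field K] [AddCommGroup V] [Module K V]
    [Field L] [Algebra K L] (q : QuadraticForm K V) (α β γ δ : L) : Prop :=
  Nonempty (L ≃ₐ[K] Subalgebra.center K (CliffordAlgebra.even q)) ∧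
  ∀ φ : L ≃ₐ[K] Subalgebra.center K (CliffordAlgebra.even q),
    ∃ c₀ : BrauerGroup.{u, u} L, HasBrauerClass L (EvenCliffordOver φ) c₀ ∧
      HasBrauerClass L (ℍ[L, α, β] ⊗[L] ℍ[L, γ, δ]) c₀

end

/-! In an orthogonal basis the Clifford generators `e i` anticommute and square to scalars `a i`. In
`C₀(q)` the elements `x = e 0 e 1`, `y = e 0 e 2` anticommute, so do `z = e 0 e 1 e 2 e 3`, `w = e 0
e 1 e 2 e 4`, and the two pairs commute; their squares are the four slots in (a). The volume element
`t`, the product of all six `e i`, is central in `C₀(q)` and squares to the signed discriminant up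
to a square, and `x, y, z, w, t` generate `C₀(q)`. Hence any embedding of `L` in the center that
hits `t` makes `C₀(q)` a quotient of the biquaternion algebra over `L`. That algebra is simple, so
the quotient map is an isomorphism without any dimension count (`nonempty_algEquiv`); it is central,
so the center is exactly `L`. Every identification of the center with `L` hits `t`, so the choice
does not matter. For (b), Gram–Schmidt turns the form into `⟨m₁/m₀, …, m₆/m₅⟩`; the products in (a)
telescope, and `(α, β) ≅ (α, -αβ)` clears the denominators. -/

namespace QuaternionAlgebra

/-! ### Tensor products with quaternion algebras: simplicity and centrality. -/

section

variable {F B : Type*} [Field F] {a b : F} [Ring B] [Algebra F B]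

/-- The real part, extended to a tensor product with a quaternion algebra. -/
noncomputable def reTensor (F B : Type*) [Field F] [Ring B] [Algebra F B] (a b : F) :
    ℍ[F, a, b] ⊗[F] B →ₗ[F] B :=
  TensorProduct.lift ((LinearMap.lsmul F B).comp (reₗ a 0 b))

@[simp]
theorem reTensor_tmul (h : ℍ[F, a, b]) (x : B) : reTensor F B a b (h ⊗ₜ x) = h.re • x := rfl

/-- The sum of the conjugates of an element of `ℍ[F, a, b] ⊗ B` by `1`, `i`, `j`, `k`. -/
theorem sum_conj_eq (ha : a ≠ 0) (hb : b ≠ 0) (x : ℍ[F, a, b] ⊗[F] B) :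
    x + a⁻¹ • ((⟨0, 1, 0, 0⟩ : ℍ[F, a, b]) ⊗ₜ 1 * x * (⟨0, 1, 0, 0⟩ : ℍ[F, a, b]) ⊗ₜ 1)
      + b⁻¹ • ((⟨0, 0, 1, 0⟩ : ℍ[F, a, b]) ⊗ₜ 1 * x * (⟨0, 0, 1, 0⟩ : ℍ[F, a, b]) ⊗ₜ 1)
      - (a * b)⁻¹ • ((⟨0, 0, 0, 1⟩ : ℍ[F, a, b]) ⊗ₜ 1 * x * (⟨0, 0, 0, 1⟩ : ℍ[F, a, b]) ⊗ₜ 1)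
      = (4 : F) • ((1 : ℍ[F, a, b]) ⊗ₜ reTensor F B a b x) := by
  induction x with
  | zero => simp
  | add x y hx hy =>
    rw [map_add, TensorProduct.tmul_add, smul_add, ← hx, ← hy]
    simp only [mul_add, add_mul, smul_add]
    abel
  | tmul h y =>
    simp only [Algebra.TensorProduct.tmul_mul_tmul, one_mul, mul_one, TensorProduct.smul_tmul',
      reTensor_tmul, TensorProduct.tmul_smul, ← TensorProduct.add_tmul, ← TensorProduct.sub_tmul]
    congr 1
    ext <;> simp <;> field_simp <;> ring

/-- The coordinates of an element of `ℍ[F, a, b] ⊗ B` with respect to `1`, `i`, `j`, `k`. -/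
theorem eq_sum_reTensor (ha : a ≠ 0) (hb : b ≠ 0) (x : ℍ[F, a, b] ⊗[F] B) :
    x = (1 : ℍ[F, a, b]) ⊗ₜ reTensor F B a b x
      + a⁻¹ • ((⟨0, 1, 0, 0⟩ : ℍ[F, a, b]) ⊗ₜ
          reTensor F B a b ((⟨0, 1, 0, 0⟩ : ℍ[F, a, b]) ⊗ₜ 1 * x))
      + b⁻¹ • ((⟨0, 0, 1, 0⟩ : ℍ[F, a, b]) ⊗ₜ
          reTensor F B a b ((⟨0, 0, 1, 0⟩ : ℍ[F, a, b]) ⊗ₜ 1 * x))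
      - (a * b)⁻¹ • ((⟨0, 0, 0, 1⟩ : ℍ[F, a, b]) ⊗ₜ
          reTensor F B a b ((⟨0, 0, 0, 1⟩ : ℍ[F, a, b]) ⊗ₜ 1 * x)) := by
  induction x with
  | zero => simp
  | add x y hx hy =>
    conv_lhs => rw [hx, hy]
    simp only [mul_add, map_add, TensorProduct.tmul_add, smul_add]
    abel
  | tmul h y =>
    simp only [Algebra.TensorProduct.tmul_mul_tmul, one_mul, TensorProduct.smul_tmul',
      reTensor_tmul, TensorProduct.tmul_smul, ← TensorProduct.add_tmul, ← TensorProduct.sub_tmul]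
    congr 1
    ext <;> simp <;> field_simp

/-- Averaging over conjugation by `1, i, j, k` shows that an ideal containing `x` contains `1 ⊗
reTensor x`. If every such real part vanishes on the ideal, then all coordinates of its elements
vanish, and the ideal is zero. -/
theorem isSimpleRing_tensor (h2 : (2 : F) ≠ 0) (ha : a ≠ 0) (hb : b ≠ 0) [IsSimpleRing B] :
    IsSimpleRing (ℍ[F, a, b] ⊗[F] B) := by
  have hinj : Function.Injective
      (Algebra.TensorProduct.includeRight : B →ₐ[F] ℍ[F, a, b] ⊗[F] B) :=
    Algebra.TensorProduct.includeRight_injective (algebraMap F ℍ[F, a, b]).injective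
  have : Nontrivial (ℍ[F, a, b] ⊗[F] B) := hinj.nontrivial
  have h4 : (4 : F) ≠ 0 := by
    rw [show (4 : F) = 2 * 2 by norm_num]
    exact mul_ne_zero h2 h2
  refine ⟨⟨fun I => or_iff_not_imp_left.2 fun hI => ?_⟩⟩
  have key : ∀ x ∈ I, reTensor F B a b x ≠ 0 → I = ⊤ := by
    intro x hx hne
    have hsm : ∀ (c : F) (y : ℍ[F, a, b] ⊗[F] B), y ∈ I → c • y ∈ I := fun c y hy => by
      rw [← one_mul y, ← smul_mul_assoc]
      exact I.mul_mem_left _ _ hy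
    have h1 : (1 : ℍ[F, a, b]) ⊗ₜ[F] reTensor F B a b x ∈ I := by
      have := sum_conj_eq ha hb x
      have hmem : (4 : F) • ((1 : ℍ[F, a, b]) ⊗ₜ[F] reTensor F B a b x) ∈ I := by
        rw [← this]
        refine I.sub_mem (I.add_mem (I.add_mem hx ?_) ?_) ?_ <;>
        exact hsm _ _ (I.mul_mem_right _ _ (I.mul_mem_left _ _ hx))
      simpa [smul_smul, inv_mul_cancel₀ h4] using hsm (4 : F)⁻¹ _ hmem
    -- The contraction of `I` to the simple ring `B` contains a nonzero element.
    have hJ : I.comap (Algebra.TensorProduct.includeRight : B →ₐ[F] ℍ[F, a, b] ⊗[F] B) = ⊤ := by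
      refine (eq_bot_or_eq_top _).resolve_left fun hbot => hne ?_
      have : reTensor F B a b x ∈
          I.comap (Algebra.TensorProduct.includeRight : B →ₐ[F] ℍ[F, a, b] ⊗[F] B) := by
        rw [TwoSidedIdeal.mem_comap]
        exact h1
      rwa [hbot, TwoSidedIdeal.mem_bot] at this
    have h11 : (1 : B) ∈
        I.comap (Algebra.TensorProduct.includeRight : B →ₐ[F] ℍ[F, a, b] ⊗[F] B) := by
      rw [hJ]; trivial
    rw [TwoSidedIdeal.mem_comap, map_one] at h11
    exact (TwoSidedIdeal.one_mem_iff I).1 h11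
  by_contra hT
  refine hI (eq_bot_iff.2 fun x hx => (TwoSidedIdeal.mem_bot _).2 ?_)
  have h0 : ∀ y ∈ I, reTensor F B a b y = 0 := fun y hy => by
    by_contra h
    exact hT (key y hy h)
  rw [eq_sum_reTensor ha hb x, h0 x hx, h0 _ (I.mul_mem_left _ _ hx), h0 _ (I.mul_mem_left _ _ hx),
    h0 _ (I.mul_mem_left _ _ hx)]
  simp

theorem isCentral_tensor (h2 : (2 : F) ≠ 0) (ha : a ≠ 0) (hb : b ≠ 0) [Algebra.IsCentral F B] :
    Algebra.IsCentral F (ℍ[F, a, b] ⊗[F] B) := by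
  have hinj : Function.Injective
      (Algebra.TensorProduct.includeRight : B →ₐ[F] ℍ[F, a, b] ⊗[F] B) :=
    Algebra.TensorProduct.includeRight_injective (algebraMap F ℍ[F, a, b]).injective
  have h4 : (4 : F) ≠ 0 := by
    rw [show (4 : F) = 2 * 2 by norm_num]
    exact mul_ne_zero h2 h2
  refine ⟨fun x hx => ?_⟩
  rw [Subalgebra.mem_center_iff] at hx
  have hsum := sum_conj_eq ha hb x
  -- A central `x` is fixed by each conjugation, so the sum is `4x` and `x` lies in `1 ⊗ B`.
  simp only [hx, mul_assoc, Algebra.TensorProduct.tmul_mul_tmul, mul_one] at hsum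
  have hi : (⟨0, 1, 0, 0⟩ : ℍ[F, a, b]) * ⟨0, 1, 0, 0⟩ = a • 1 := by ext <;> simp
  have hj : (⟨0, 0, 1, 0⟩ : ℍ[F, a, b]) * ⟨0, 0, 1, 0⟩ = b • 1 := by ext <;> simp
  have hk : (⟨0, 0, 0, 1⟩ : ℍ[F, a, b]) * ⟨0, 0, 0, 1⟩ = -(a * b) • 1 := by ext <;> simp
  rw [hi, hj, hk] at hsum
  have hx1 : x = (1 : ℍ[F, a, b]) ⊗ₜ[F] reTensor F B a b x := by
    refine smul_right_injective _ h4 (Eq.trans ?_ hsum)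
    simp only [← TensorProduct.smul_tmul', ← Algebra.TensorProduct.one_def, mul_smul_comm, mul_one,
      smul_smul, inv_mul_cancel₀ ha, inv_mul_cancel₀ hb, mul_neg,
      inv_mul_cancel₀ (mul_ne_zero ha hb)]
    module
  have hc : reTensor F B a b x ∈ Subalgebra.center F B := by
    refine Subalgebra.mem_center_iff.2 fun y => hinj ?_
    have := hx (1 ⊗ₜ y)
    rw [hx1] at this
    simpa using this
  obtain ⟨c, hc⟩ := (Algebra.IsCentral.mem_center_iff F).1 hc
  refine Algebra.mem_bot.2 ⟨c, ?_⟩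
  rw [hx1, hc, Algebra.TensorProduct.algebraMap_apply, Algebra.algebraMap_eq_smul_one,
    Algebra.algebraMap_eq_smul_one, TensorProduct.smul_tmul]

theorem isSimpleRing (h2 : (2 : F) ≠ 0) (ha : a ≠ 0) (hb : b ≠ 0) : IsSimpleRing ℍ[F, a, b] :=
  have := isSimpleRing_tensor (B := F) h2 ha hb
  IsSimpleRing.of_ringEquiv (Algebra.TensorProduct.rid F F ℍ[F, a, b]).toRingEquiv this

theorem isCentral (h2 : (2 : F) ≠ 0) (ha : a ≠ 0) (hb : b ≠ 0) : Algebra.IsCentral F ℍ[F, a, b] :=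
  have := isCentral_tensor (B := F) h2 ha hb
  Algebra.IsCentral.of_algEquiv F _ _ (Algebra.TensorProduct.rid F F ℍ[F, a, b])

/-- The isomorphism `(a, b) ≅ (a, -ab)`. -/
theorem nonempty_algEquiv_neg_mul (ha : a ≠ 0) :
    Nonempty (ℍ[F, a, b] ≃ₐ[F] ℍ[F, a, -(a * b)]) := by
  -- In `(a, b)` the pair `i, ij` satisfies the relations of `(a, -ab)`, with product `i(ij) = aj`;
  -- dividing by `a` recovers `j` and gives the inverse `g`.
  let f : Basis ℍ[F, a, b] a 0 (-(a * b)) :=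
    { i := ⟨0, 1, 0, 0⟩
      j := ⟨0, 0, 0, 1⟩
      k := ⟨0, 0, a, 0⟩
      i_mul_i := by ext <;> simp
      j_mul_j := by ext <;> simp
      i_mul_j := by ext <;> simp
      j_mul_i := by ext <;> simp }
  let g : Basis ℍ[F, a, -(a * b)] a 0 b :=
    { i := ⟨0, 1, 0, 0⟩
      j := ⟨0, 0, 0, a⁻¹⟩
      k := ⟨0, 0, 1, 0⟩
      i_mul_i := by ext <;> simp
      j_mul_j := by ext <;> simp; field_simp
      i_mul_j := by ext <;> simp [ha]
      j_mul_i := by ext <;> simp [ha] }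
  refine ⟨AlgEquiv.ofAlgHom g.liftHom f.liftHom ?_ ?_⟩
  · ext <;> simp [f, g, Basis.lift]
  · ext <;> simp [f, g, Basis.lift, ha]

end

end QuaternionAlgebra

/-! ### Recognizing biquaternion algebras by generators. -/

/-- The elements `x, y, z, w` satisfy the relations of the standard generators of
`(a, b) ⊗ (c, d)`. -/
structure IsBiquaternionSystem {F A : Type*} [Field F] [Ring A] [Algebra F A] (a b c d : F)
    (x y z w : A) : Prop where
  x_sq : x * x = a • 1
  y_sq : y * y = b • 1
  z_sq : z * z = c • 1
  w_sq : w * w = d • 1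
  y_mul_x : y * x = -(x * y)
  w_mul_z : w * z = -(z * w)
  commute_xz : Commute x z
  commute_xw : Commute x w
  commute_yz : Commute y z
  commute_yw : Commute y w

namespace IsBiquaternionSystem

variable {F A : Type*} [Field F] [Ring A] [Algebra F A] {a b c d : F} {x y z w : A}

/-- The homomorphism from a quaternion algebra given by two anticommuting elements. -/
noncomputable def quaternionHom (hx : x * x = a • 1) (hy : y * y = b • 1)
    (hyx : y * x = -(x * y)) : ℍ[F, a, b] →ₐ[F] A :=
  QuaternionAlgebra.Basis.liftHom
    { i := x, j := y, k := x * y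
      i_mul_i := by simp [hx]
      j_mul_j := hy
      i_mul_j := rfl
      j_mul_i := by simp [hyx] }

theorem commute_quaternionHom (h : IsBiquaternionSystem a b c d x y z w)
    (p : ℍ[F, a, b]) (r : ℍ[F, c, d]) :
    Commute (quaternionHom h.x_sq h.y_sq h.y_mul_x p)
      (quaternionHom h.z_sq h.w_sq h.w_mul_z r) := by
  have key : ∀ {s t : A}, Commute s z → Commute s w → Commute t z → Commute t w →
      Commute (s * t) (z * w) := fun h1 h2 h3 h4 =>
    (h1.mul_right h2).mul_left (h3.mul_right h4)
  have hxy := key h.commute_xz h.commute_xw h.commute_yz h.commute_yw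
  have hxz := h.commute_xz
  have hxw := h.commute_xw
  have hyz := h.commute_yz
  have hyw := h.commute_yw
  have alg : ∀ (s : F) (t : A), Commute (algebraMap F A s) t := Algebra.commutes
  have alg' : ∀ (s : F) (t : A), Commute t (algebraMap F A s) := fun s t => (alg s t).symm
  have cm : ∀ (t : A), Commute x t → Commute y t →
      Commute (quaternionHom h.x_sq h.y_sq h.y_mul_x p) t := fun t h1 h2 =>
    (((alg _ _).add_left (h1.smul_left _)).add_left (h2.smul_left _)).add_left
      ((h1.mul_left h2).smul_left _)
  have hz := cm z hxz hyz
  have hw := cm w hxw hyw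
  exact (((alg' _ _).add_right (hz.smul_right _)).add_right (hw.smul_right _)).add_right
    ((hz.mul_right hw).smul_right _)

/-- An algebra generated by a system of generators of `(a, b) ⊗ (c, d)` is isomorphic to it. -/
theorem nonempty_algEquiv [Nontrivial A] (h : IsBiquaternionSystem a b c d x y z w)
    (h2 : (2 : F) ≠ 0) (ha : a ≠ 0) (hb : b ≠ 0) (hc : c ≠ 0) (hd : d ≠ 0)
    (hgen : Algebra.adjoin F {x, y, z, w} = ⊤) :
    Nonempty (ℍ[F, a, b] ⊗[F] ℍ[F, c, d] ≃ₐ[F] A) := by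
  have := QuaternionAlgebra.isSimpleRing h2 hc hd
  have := QuaternionAlgebra.isSimpleRing_tensor (B := ℍ[F, c, d]) h2 ha hb
  let f : ℍ[F, a, b] ⊗[F] ℍ[F, c, d] →ₐ[F] A :=
    Algebra.TensorProduct.lift (quaternionHom h.x_sq h.y_sq h.y_mul_x)
      (quaternionHom h.z_sq h.w_sq h.w_mul_z) h.commute_quaternionHom
  have hl : ∀ p, quaternionHom h.x_sq h.y_sq h.y_mul_x p ∈ f.range := fun p =>
    ⟨p ⊗ₜ 1, by simp [f]⟩
  have hr : ∀ p, quaternionHom h.z_sq h.w_sq h.w_mul_z p ∈ f.range := fun p =>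
    ⟨1 ⊗ₜ p, by simp [f]⟩
  -- Injectivity comes from simplicity of the source and nontriviality of `A`.
  refine ⟨AlgEquiv.ofBijective f ⟨f.toRingHom.injective, ?_⟩⟩
  rw [← AlgHom.range_eq_top, eq_top_iff, ← hgen, Algebra.adjoin_le_iff]
  rintro t (rfl | rfl | rfl | rfl)
  · convert hl ⟨0, 1, 0, 0⟩
    simp [quaternionHom, QuaternionAlgebra.Basis.lift]
  · convert hl ⟨0, 0, 1, 0⟩
    simp [quaternionHom, QuaternionAlgebra.Basis.lift]
  · convert hr ⟨0, 1, 0, 0⟩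
    simp [quaternionHom, QuaternionAlgebra.Basis.lift]
  · convert hr ⟨0, 0, 1, 0⟩
    simp [quaternionHom, QuaternionAlgebra.Basis.lift]

end IsBiquaternionSystem

/-! ### The discriminant extension as the center. -/

/-- A `K`-embedding of a quadratic extension `K(δ)` with `δ² = Δ`, sending `δ` to a given square
root of `Δ` in a commutative ring. -/
theorem exists_algHom_of_sq_eq {K L R : Type*} [Field K] [Field L] [Algebra K L] [CommRing R]
    [Algebra K R] {Δ : K} (hΔ : ¬ IsSquare Δ) {δ : L} (hδ : δ ^ 2 = algebraMap K L Δ)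
    (htop : IntermediateField.adjoin K {δ} = ⊤) {r : R} (hr : r ^ 2 = algebraMap K R Δ) :
    ∃ f : L →ₐ[K] R, f δ = r := by
  have hirr : Irreducible (Polynomial.X ^ 2 - Polynomial.C Δ) :=
    X_pow_sub_C_irreducible_of_prime Nat.prime_two fun s hs => hΔ ⟨s, by rw [← hs, sq]⟩
  have hmonic : (Polynomial.X ^ 2 - Polynomial.C Δ).Monic := Polynomial.monic_X_pow_sub_C _ two_ne_zero
  have hmin : minpoly K δ = Polynomial.X ^ 2 - Polynomial.C Δ :=
    (minpoly.eq_of_irreducible_of_monic hirr (by simp [hδ]) hmonic).symm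
  have hint : IsIntegral K δ := ⟨_, hmonic, by simp [hδ]⟩
  have hadj : Algebra.adjoin K {δ} = ⊤ := by
    rw [← IntermediateField.adjoin_simple_toSubalgebra_of_isAlgebraic hint.isAlgebraic, htop]
    rfl
  let pb := PowerBasis.ofAdjoinEqTop hint hadj
  have hgen : pb.gen = δ := by simp [pb]
  have hroot : Polynomial.aeval r (minpoly K pb.gen) = 0 := by
    rw [hgen, hmin]
    simp [hr]
  exact ⟨pb.lift r hroot, (congrArg _ hgen.symm).trans (pb.lift_gen r hroot)⟩

section Center

variable {K L : Type*} {A : Type*} [Field K] [Field L] [Algebra K L] [Ring A] [Algebra K A]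

/-- The structure of an `L`-algebra on `A` defined by a `K`-homomorphism from `L` to the center. -/
abbrev algebraOfCenter (ψ : L →ₐ[K] Subalgebra.center K A) : Algebra L A :=
  RingHom.toAlgebra' (((Subalgebra.center K A).val.comp ψ).toRingHom)
    (fun x y => ((Subalgebra.mem_center_iff.mp (ψ x).2) y).symm)

/-- Over `L` the generator `t` becomes a scalar, so `x, y, z, w` alone generate `A`. -/
theorem nonempty_algEquiv_algebraOfCenter [Nontrivial A] {a b c d : K} {x y z w t : A}
    (h : IsBiquaternionSystem a b c d x y z w)
    (h2 : (2 : K) ≠ 0) (ha : a ≠ 0) (hb : b ≠ 0) (hc : c ≠ 0) (hd : d ≠ 0)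
    (hgen : Algebra.adjoin K {x, y, z, w, t} = ⊤)
    (ψ : L →ₐ[K] Subalgebra.center K A) (ht : ∃ l, (ψ l : A) = t) :
    let _ := algebraOfCenter ψ
    Nonempty (ℍ[L, algebraMap K L a, algebraMap K L b] ⊗[L]
      ℍ[L, algebraMap K L c, algebraMap K L d] ≃ₐ[L] A) := by
  let _ := algebraOfCenter ψ
  have hmap : ∀ l : L, algebraMap L A l = (ψ l : A) := fun _ => rfl
  have : IsScalarTower K L A := IsScalarTower.of_algebraMap_eq fun k => by
    rw [hmap, AlgHom.commutes]
    rfl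
  have hne : ∀ {k : K}, k ≠ 0 → algebraMap K L k ≠ 0 := fun hk =>
    (map_ne_zero (algebraMap K L)).2 hk
  have hL : IsBiquaternionSystem (algebraMap K L a) (algebraMap K L b) (algebraMap K L c)
      (algebraMap K L d) x y z w :=
    ⟨by simpa using h.x_sq, by simpa using h.y_sq, by simpa using h.z_sq, by simpa using h.w_sq,
      h.y_mul_x, h.w_mul_z, h.commute_xz, h.commute_xw, h.commute_yz, h.commute_yw⟩
  refine hL.nonempty_algEquiv (map_ofNat (algebraMap K L) 2 ▸ hne h2) (hne ha) (hne hb) (hne hc) (hne hd) ?_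
  have hle : (⊤ : Subalgebra K A) ≤
      (Algebra.adjoin L ({x, y, z, w} : Set A)).restrictScalars K := by
    rw [← hgen, Algebra.adjoin_le_iff]
    have hs : ∀ s ∈ ({x, y, z, w} : Set A),
        s ∈ Algebra.adjoin L ({x, y, z, w} : Set A) := fun s hs => Algebra.subset_adjoin hs
    rintro s (rfl | rfl | rfl | rfl | rfl)
    · exact hs _ (by simp)
    · exact hs _ (by simp)
    · exact hs _ (by simp)
    · exact hs _ (by simp)
    · obtain ⟨l, rfl⟩ := ht
      exact (Algebra.adjoin L ({x, y, z, w} : Set A)).algebraMap_mem l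
  exact eq_top_iff.2 fun s _ => hle (x := s) trivial

end Center

theorem evenCliffordClassEq_of_isBiquaternionSystem {K V L : Type u} [Field K] [AddCommGroup V]
    [Module K V] [Field L] [Algebra K L] {q : QuadraticForm K V} [Invertible (2 : K)]
    {a b c d Δ : K} {x y z w t : CliffordAlgebra.even q}
    (h : IsBiquaternionSystem a b c d x y z w)
    (ha : a ≠ 0) (hb : b ≠ 0) (hc : c ≠ 0) (hd : d ≠ 0)
    (hgen : Algebra.adjoin K {x, y, z, w, t} = ⊤)
    (ht : t ∈ Subalgebra.center K (CliffordAlgebra.even q)) (htt : t * t = Δ • 1)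
    (hΔ : ¬ IsSquare Δ) {δ : L} (hδ : δ ^ 2 = algebraMap K L Δ)
    (htop : IntermediateField.adjoin K {δ} = ⊤) :
    EvenCliffordClassEq q (algebraMap K L a) (algebraMap K L b) (algebraMap K L c)
      (algebraMap K L d) := by
  have h2 : (2 : K) ≠ 0 := Invertible.ne_zero 2
  have hne : ∀ {k : K}, k ≠ 0 → algebraMap K L k ≠ 0 := fun hk =>
    (map_ne_zero (algebraMap K L)).2 hk
  have h2L : (2 : L) ≠ 0 := map_ofNat (algebraMap K L) 2 ▸ hne h2
  have := QuaternionAlgebra.isSimpleRing h2L (hne hc) (hne hd)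
  have := QuaternionAlgebra.isCentral h2L (hne hc) (hne hd)
  have := QuaternionAlgebra.isSimpleRing_tensor
    (B := ℍ[L, algebraMap K L c, algebraMap K L d]) h2L (hne ha) (hne hb)
  have := QuaternionAlgebra.isCentral_tensor
    (B := ℍ[L, algebraMap K L c, algebraMap K L d]) h2L (hne ha) (hne hb)
  obtain ⟨ψ, hψ⟩ := exists_algHom_of_sq_eq (L := L) (r := (⟨t, ht⟩ : Subalgebra.center K _))
    hΔ hδ htop (by
      refine Subtype.ext ?_
      rw [sq]
      simpa [Algebra.algebraMap_eq_smul_one] using htt)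
  -- Through `ψ` the even Clifford algebra is a biquaternion algebra over `L`, hence central, so its
  -- center is the image of `ψ`.
  have hsurj : Function.Surjective ψ := by
    intro s
    let _ := algebraOfCenter ψ
    obtain ⟨e⟩ := nonempty_algEquiv_algebraOfCenter h h2 ha hb hc hd hgen ψ
      ⟨δ, congrArg Subtype.val hψ⟩
    have := Algebra.IsCentral.of_algEquiv L _ _ e
    obtain ⟨l, hl⟩ := (Algebra.IsCentral.mem_center_iff L
      (D := CliffordAlgebra.even q) (x := s.1)).1
      (Subalgebra.mem_center_iff.2 (Subalgebra.mem_center_iff.1 s.2))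
    exact ⟨l, Subtype.ext hl.symm⟩
  refine ⟨⟨AlgEquiv.ofBijective ψ ⟨ψ.toRingHom.injective, hsurj⟩⟩, fun φ => ?_⟩
  -- An arbitrary `φ` also has `t` in its image, because `t` is central.
  obtain ⟨e⟩ := nonempty_algEquiv_algebraOfCenter h h2 ha hb hc hd hgen φ.toAlgHom
    ⟨φ.symm ⟨t, ht⟩, congrArg Subtype.val (φ.apply_symm_apply ⟨t, ht⟩)⟩
  have e : ℍ[L, algebraMap K L a, algebraMap K L b] ⊗[L]
      ℍ[L, algebraMap K L c, algebraMap K L d] ≃ₐ[L] EvenCliffordOver φ := e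
  let T : CSA.{u, u} L :=
    { AlgCat.of L (ℍ[L, algebraMap K L a, algebraMap K L b] ⊗[L]
        ℍ[L, algebraMap K L c, algebraMap K L d]) with
      isCentral := ‹_›
      isSimple := ‹_›
      fin_dim := inferInstanceAs (FiniteDimensional L
        (ℍ[L, algebraMap K L a, algebraMap K L b] ⊗[L]
        ℍ[L, algebraMap K L c, algebraMap K L d])) }
  exact ⟨Quotient.mk _ T, ⟨T, ⟨e.symm⟩, rfl⟩, ⟨T, ⟨AlgEquiv.refl⟩, rfl⟩⟩

/-! ### Computations with six anticommuting generators. -/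

/-- Anticommuting square roots `e i` of scalars `a i`. -/
structure IsCliffordSystem {K A : Type*} [Field K] [Ring A] [Algebra K A] {n : ℕ}
    (a : Fin n → K) (e : Fin n → A) : Prop where
  sq : ∀ i, e i * e i = a i • 1
  anticomm : ∀ i j, i < j → e j * e i = -(e i * e j)

namespace IsCliffordSystem

variable {K A : Type*} [Field K] [Ring A] [Algebra K A]

theorem sq_assoc {n : ℕ} {a : Fin n → K} {e : Fin n → A} (h : IsCliffordSystem a e) (i : Fin n)
    (x : A) : e i * (e i * x) = a i • x := by
  rw [← mul_assoc, h.sq, smul_mul_assoc, one_mul]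

theorem anticomm_assoc {n : ℕ} {a : Fin n → K} {e : Fin n → A} (h : IsCliffordSystem a e)
    (i j : Fin n) (hij : i < j) (x : A) : e j * (e i * x) = -(e i * (e j * x)) := by
  rw [← mul_assoc, h.anticomm i j hij, neg_mul, mul_assoc]

variable {a : Fin 6 → K} {e : Fin 6 → A}

theorem isBiquaternionSystem (h : IsCliffordSystem a e) :
    IsBiquaternionSystem (-(a 0 * a 1)) (-(a 0 * a 2)) (a 0 * a 1 * a 2 * a 3)
      (a 0 * a 1 * a 2 * a 4) (e 0 * e 1) (e 0 * e 2) (e 0 * e 1 * (e 2 * e 3))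
      (e 0 * e 1 * (e 2 * e 4)) := by
  constructor <;> (try unfold Commute SemiconjBy) <;>
  simp [h.sq, h.sq_assoc, h.anticomm, h.anticomm_assoc, mul_assoc, smul_smul] <;>
  module

theorem volume_mul_self (h : IsCliffordSystem a e) :
    (e 0 * e 1 * (e 2 * e 3) * (e 4 * e 5)) * (e 0 * e 1 * (e 2 * e 3) * (e 4 * e 5))
      = (-(a 0 * a 1 * a 2 * a 3 * a 4 * a 5)) • (1 : A) := by
  simp [h.sq, h.anticomm_assoc, mul_assoc, smul_smul]
  module

/-- Each `e i` commutes with itself and anticommutes with the five other factors. -/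
theorem anticomm_volume (h : IsCliffordSystem a e) (i : Fin 6) :
    (e 0 * e 1 * (e 2 * e 3) * (e 4 * e 5)) * e i
      = -(e i * (e 0 * e 1 * (e 2 * e 3) * (e 4 * e 5))) := by
  fin_cases i <;>
  simp [h.sq, h.sq_assoc, h.anticomm, h.anticomm_assoc, mul_assoc]

theorem commute_volume (h : IsCliffordSystem a e) (i j : Fin 6) :
    Commute (e i * e j) (e 0 * e 1 * (e 2 * e 3) * (e 4 * e 5)) := by
  unfold Commute SemiconjBy
  rw [← mul_assoc (_ * _) (e i) (e j), h.anticomm_volume, neg_mul, mul_assoc (e i) _ (e j),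
    h.anticomm_volume, mul_neg, neg_neg, mul_assoc]

/-- The products `xyz`, `xyw` and `xy(e 0 e 3)(e 0 e 4)t` are nonzero multiples of `e 0 e 3`, `e 0 e
4`, `e 0 e 5`; then `e i e j` is obtained from `(e i e 0)(e 0 e j)`. -/
theorem mul_mem_of_mem (h : IsCliffordSystem a e) (ha : ∀ i, a i ≠ 0) {S : Subalgebra K A} (hx : e 0 * e 1 ∈ S)
    (hy : e 0 * e 2 ∈ S) (hz : e 0 * e 1 * (e 2 * e 3) ∈ S) (hw : e 0 * e 1 * (e 2 * e 4) ∈ S)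
    (ht : e 0 * e 1 * (e 2 * e 3) * (e 4 * e 5) ∈ S) (i j : Fin 6) : e i * e j ∈ S := by
  have cancel : ∀ {c : K} {s : A}, c ≠ 0 → c • s ∈ S → s ∈ S := fun {c s} hc hs => by
    simpa [smul_smul, inv_mul_cancel₀ hc] using S.smul_mem hs c⁻¹
  have h3 : e 0 * e 3 ∈ S := by
    refine cancel (c := a 0 * a 1 * a 2) (by simp [ha]) ?_
    convert S.mul_mem (S.mul_mem hx hy) hz using 1
    simp [h.sq_assoc, h.anticomm_assoc, mul_assoc, smul_smul]
    module
  have h4 : e 0 * e 4 ∈ S := by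
    refine cancel (c := a 0 * a 1 * a 2) (by simp [ha]) ?_
    convert S.mul_mem (S.mul_mem hx hy) hw using 1
    simp [h.sq_assoc, h.anticomm_assoc, mul_assoc, smul_smul]
    module
  have h5 : e 0 * e 5 ∈ S := by
    refine cancel (c := a 0 * a 0 * a 1 * a 2 * a 3 * a 4) (by simp [ha]) ?_
    convert S.mul_mem (S.mul_mem (S.mul_mem hx hy) (S.mul_mem h3 h4)) ht using 1
    simp [h.sq_assoc, h.anticomm_assoc, mul_assoc, smul_smul]
    module
  have h0 : ∀ k, e 0 * e k ∈ S := by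
    intro k
    fin_cases k
    · exact h.sq 0 ▸ S.smul_mem S.one_mem _
    all_goals assumption
  have h0' : e i * e 0 ∈ S := by
    rcases eq_or_ne i 0 with rfl | hi
    · exact h0 0
    · rw [h.anticomm 0 i (Fin.pos_iff_ne_zero.2 hi)]
      exact S.neg_mem (h0 i)
  refine cancel (ha 0) ?_
  convert S.mul_mem h0' (h0 j) using 1
  rw [mul_assoc, h.sq_assoc, mul_smul_comm]

end IsCliffordSystem

/-! ### The even Clifford algebra of an orthogonal basis. -/

section Even

variable {K V : Type*} [Field K] [AddCommGroup V] [Module K V] {q : QuadraticForm K V}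

theorem isCliffordSystem_ι [Invertible (2 : K)] {n : ℕ} {v : Fin n → V}
    (hv : (QuadraticMap.associated (R := K) q).IsOrthoᵢ v) :
    IsCliffordSystem (fun i => q (v i)) (fun i => CliffordAlgebra.ι q (v i)) where
  sq i := by rw [CliffordAlgebra.ι_sq_scalar, Algebra.algebraMap_eq_smul_one]
  anticomm i j hij := by
    exact CliffordAlgebra.ι_mul_ι_comm_of_isOrtho
      (QuadraticMap.associated_isOrtho.1 (hv hij.ne'))

/-- The product of two vectors in the even Clifford algebra. -/
noncomputable def evenMul (q : QuadraticForm K V) (m₁ m₂ : V) : CliffordAlgebra.even q :=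
  (CliffordAlgebra.even.ι q).bilin m₁ m₂

@[simp]
theorem coe_evenMul (m₁ m₂ : V) :
    (evenMul q m₁ m₂ : CliffordAlgebra q) = CliffordAlgebra.ι q m₁ * CliffordAlgebra.ι q m₂ := rfl

/-- Products of two vectors generate the even part, and they are bilinear in the vectors. -/
theorem even_eq_top_of_basis {n : Type*} [Fintype n] (v : Module.Basis n K V)
    {S : Subalgebra K (CliffordAlgebra.even q)} (hS : ∀ i j, evenMul q (v i) (v j) ∈ S) :
    S = ⊤ := by
  have hmul : ∀ m₁ m₂, evenMul q m₁ m₂ ∈ S := by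
    intro m₁ m₂
    rw [← v.sum_repr m₁, ← v.sum_repr m₂]
    simp only [evenMul, map_sum, map_smul, LinearMap.sum_apply, LinearMap.smul_apply]
    exact S.sum_mem fun j _ => S.smul_mem (S.sum_mem fun i _ => S.smul_mem (hS i j) _) _
  have key : ∀ (x : CliffordAlgebra q) (hx : x ∈ CliffordAlgebra.evenOdd q 0),
      x ∈ S.map (CliffordAlgebra.even q).val := by
    intro x hx
    induction x, hx using CliffordAlgebra.even_induction with
    | algebraMap r => exact Subalgebra.algebraMap_mem _ r
    | add x y hx hy ihx ihy => exact Subalgebra.add_mem _ ihx ihy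
    | ι_mul_ι_mul m₁ m₂ x hx ih => exact Subalgebra.mul_mem _ ⟨_, hmul m₁ m₂, rfl⟩ ih
  refine eq_top_iff.2 fun x _ => ?_
  obtain ⟨y, hy, hyx⟩ := key x.1 x.2
  rwa [← Subtype.ext hyx]

end Even

theorem evenCliffordClassEq_of_isOrtho {K V L : Type u} [Field K] [Invertible (2 : K)]
    [AddCommGroup V] [Module K V] [Field L] [Algebra K L] {q : QuadraticForm K V}
    (v : Module.Basis (Fin 6) K V) (hv : (QuadraticMap.associated (R := K) q).IsOrthoᵢ v)
    (hne : ∀ i, q (v i) ≠ 0) {Δ s : K}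
    (hs : Δ = s * s * -(q (v 0) * q (v 1) * q (v 2) * q (v 3) * q (v 4) * q (v 5)))
    (hΔ : ¬ IsSquare Δ) {δ : L} (hδ : δ ^ 2 = algebraMap K L Δ)
    (htop : IntermediateField.adjoin K {δ} = ⊤) :
    EvenCliffordClassEq q (algebraMap K L (-(q (v 0) * q (v 1))))
      (algebraMap K L (-(q (v 0) * q (v 2))))
      (algebraMap K L (q (v 0) * q (v 1) * q (v 2) * q (v 3)))
      (algebraMap K L (q (v 0) * q (v 1) * q (v 2) * q (v 4))) := by
  have hs0 : s ≠ 0 := by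
    rintro rfl
    exact hΔ ⟨0, by simp [hs]⟩
  have hC := isCliffordSystem_ι hv
  let m : Fin 6 → Fin 6 → CliffordAlgebra.even q := fun i j => evenMul q (v i) (v j)
  let t := m 0 1 * m 2 3 * m 4 5
  have hB : IsBiquaternionSystem (-(q (v 0) * q (v 1))) (-(q (v 0) * q (v 2)))
      (q (v 0) * q (v 1) * q (v 2) * q (v 3)) (q (v 0) * q (v 1) * q (v 2) * q (v 4))
      (m 0 1) (m 0 2) (m 0 1 * m 2 3) (m 0 1 * m 2 4) :=
    have h := hC.isBiquaternionSystem
    ⟨Subtype.ext h.x_sq, Subtype.ext h.y_sq, Subtype.ext h.z_sq, Subtype.ext h.w_sq,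
      Subtype.ext h.y_mul_x, Subtype.ext h.w_mul_z, Subtype.ext h.commute_xz,
      Subtype.ext h.commute_xw, Subtype.ext h.commute_yz, Subtype.ext h.commute_yw⟩
  have hcent : t ∈ Subalgebra.center K (CliffordAlgebra.even q) := by
    have : Subalgebra.centralizer K {t} = ⊤ := even_eq_top_of_basis v fun i j =>
      (Subalgebra.mem_centralizer_iff K).2 fun g hg => by
        rw [Set.mem_singleton_iff.1 hg]
        exact Subtype.ext (hC.commute_volume i j).symm.eq
    refine Subalgebra.mem_center_iff.2 fun x => ?_
    have hx : x ∈ Subalgebra.centralizer K {t} := this ▸ trivial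
    exact ((Subalgebra.mem_centralizer_iff K).1 hx t rfl).symm
  -- The factor `s` makes the square of the central generator exactly `Δ`, the discriminant in the
  -- original basis.
  have hgen : Algebra.adjoin K {m 0 1, m 0 2, m 0 1 * m 2 3, m 0 1 * m 2 4, s • t} = ⊤ := by
    refine even_eq_top_of_basis v fun i j => ?_
    set S := Algebra.adjoin K {m 0 1, m 0 2, m 0 1 * m 2 3, m 0 1 * m 2 4, s • t} with hSdef
    have hsub : ∀ u ∈ ({m 0 1, m 0 2, m 0 1 * m 2 3, m 0 1 * m 2 4, s • t} : Set _), u ∈ S :=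
      fun u hu => Algebra.subset_adjoin hu
    have ht : t ∈ S := by
      simpa [smul_smul, inv_mul_cancel₀ hs0] using S.smul_mem (hsub (s • t) (by simp)) s⁻¹
    obtain ⟨y, hy, hyx⟩ := hC.mul_mem_of_mem hne (S := S.map (CliffordAlgebra.even q).val)
      ⟨_, hsub (m 0 1) (by simp), rfl⟩ ⟨_, hsub (m 0 2) (by simp), rfl⟩
      ⟨_, hsub (m 0 1 * m 2 3) (by simp), rfl⟩ ⟨_, hsub (m 0 1 * m 2 4) (by simp), rfl⟩
      ⟨_, ht, rfl⟩ i j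
    have : y = evenMul q (v i) (v j) := Subtype.ext hyx
    exact this ▸ hy
  have htt : t * t = (-(q (v 0) * q (v 1) * q (v 2) * q (v 3) * q (v 4) * q (v 5))) • 1 :=
    Subtype.ext hC.volume_mul_self
  refine evenCliffordClassEq_of_isBiquaternionSystem hB (by simp [hne]) (by simp [hne])
    (by simp [hne]) (by simp [hne]) hgen (Subalgebra.smul_mem _ hcent s) ?_ hΔ hδ htop
  rw [smul_mul_smul_comm, htt, smul_smul, hs]
-- Gram–Schmidt and leading principal minors.
open Matrix in
/-- Gram–Schmidt orthogonalization of a symmetric matrix with nonzero leading principal minors. -/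
theorem exists_transpose_mul_mul_eq_diagonal {K : Type*} [Field K] {n : ℕ}
    (M : Matrix (Fin n) (Fin n) K) (hM : M.IsSymm)
    (hm : ∀ (i : ℕ) (hi : i ≤ n), leadingPrincipalMinor M i hi ≠ 0) :
    ∃ U : Matrix (Fin n) (Fin n) K, U.det = 1 ∧ Uᵀ * M * U = diagonal fun i : Fin n =>
      leadingPrincipalMinor M (i + 1) i.isLt / leadingPrincipalMinor M i i.isLt.le := by
  induction n with
  | zero => exact ⟨1, by simp, Subsingleton.elim _ _⟩
  | succ n ih =>
    let ε : Fin n ⊕ Fin 1 ≃ Fin (n + 1) := finSumFinEquiv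
    let B := (M.submatrix ε ε).toBlocks₁₁
    let w := (M.submatrix ε ε).toBlocks₁₂
    let c := (M.submatrix ε ε).toBlocks₂₂
    have hB : B.IsSymm := by
      ext i j
      exact hM.apply _ _
    have hN : M.submatrix ε ε = fromBlocks B w wᵀ c := by
      rw [← fromBlocks_toBlocks (M.submatrix ε ε)]
      congr 1
      ext i j
      exact hM.apply _ _
    have hBdet : B.det = leadingPrincipalMinor M n n.le_succ := rfl
    have hMdet : M.det = leadingPrincipalMinor M (n + 1) le_rfl := rfl
    have hB0 : B.det ≠ 0 := hBdet ▸ hm n _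
    have hBu : IsUnit B.det := isUnit_iff_ne_zero.2 hB0
    obtain ⟨U, hU, hUB⟩ := ih B hB fun i hi => hm i (hi.trans n.le_succ)
    -- The column `-B⁻¹w` clears the off-diagonal blocks and leaves the Schur complement `s`; as `W`
    -- has determinant 1, `s` is `det M / det B`.
    let W : Matrix (Fin n ⊕ Fin 1) (Fin n ⊕ Fin 1) K := fromBlocks U (-(B⁻¹ * w)) 0 1
    let s : Matrix (Fin 1) (Fin 1) K := c - wᵀ * B⁻¹ * w
    have hWN : Wᵀ * M.submatrix ε ε * W = fromBlocks (Uᵀ * B * U) 0 0 s := by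
      have hBi : (B⁻¹)ᵀ = B⁻¹ := by rw [transpose_nonsing_inv, hB.eq]
      simp only [W, s, hN, fromBlocks_transpose, fromBlocks_multiply]
      congr 1
      · simp
      · simp [Matrix.mul_assoc, mul_nonsing_inv_cancel_left _ _ hBu]
      · simp [hBi, nonsing_inv_mul_cancel_right _ _ hBu]
      · simp [hBi, nonsing_inv_mul_cancel_right _ _ hBu]
        abel
    have hW : W.det = 1 := by simp [W, hU]
    have hs : B.det * s 0 0 = M.det := by
      have := congrArg det hWN
      rw [det_fromBlocks_zero₂₁, det_mul, det_mul, det_mul, det_mul, det_transpose, det_transpose,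
        hW, hU, det_submatrix_equiv_self, det_fin_one] at this
      simpa using this.symm
    refine ⟨W.submatrix ε.symm ε.symm, by rw [det_submatrix_equiv_self, hW], ?_⟩
    have hM' : M = (M.submatrix ε ε).submatrix ε.symm ε.symm := by simp
    conv_lhs => rw [hM']
    rw [transpose_submatrix, submatrix_mul_equiv, submatrix_mul_equiv, hWN, hUB]
    have hdiag : fromBlocks (diagonal fun i : Fin n => leadingPrincipalMinor B (i + 1) i.isLt /
        leadingPrincipalMinor B i i.isLt.le) 0 0 s = (diagonal fun i : Fin (n + 1) =>
        leadingPrincipalMinor M (i + 1) i.isLt /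
          leadingPrincipalMinor M i i.isLt.le).submatrix ε ε := by
      rw [submatrix_diagonal_equiv]
      have hs' : s = diagonal fun _ => leadingPrincipalMinor M (n + 1) le_rfl /
          leadingPrincipalMinor M n n.le_succ := by
        ext i j
        rw [Subsingleton.elim i 0, Subsingleton.elim j 0, diagonal_apply_eq, eq_div_iff (hm n _),
          ← hBdet, ← hMdet, ← hs, mul_comm]
      rw [hs', fromBlocks_diagonal]
      congr 1
      ext (i | i)
      · rfl
      · obtain rfl := Subsingleton.elim i 0
        rfl
    rw [hdiag]
    simp

theorem toMatrix_apply_eq_associated {K V n : Type*} [Field K] [Invertible (2 : K)]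
    [AddCommGroup V] [Module K V] [Fintype n] [DecidableEq n] (b : Module.Basis n K V)
    (q : QuadraticForm K V) (i j : n) :
    QuadraticForm.toMatrix b q i j = QuadraticMap.associated (R := K) q (b i) (b j) := by
  simp [QuadraticForm.toMatrix]

/-- A quadratic form whose Gram matrix has nonzero leading principal minors `mᵢ` is the diagonal
form with entries `mᵢ₊₁ / mᵢ`. -/
theorem equivalent_weightedSumSquares_of_leadingPrincipalMinor {K V : Type*} [Field K]
    [Invertible (2 : K)] [AddCommGroup V] [Module K V] {n : ℕ} (b : Module.Basis (Fin n) K V)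
    (q : QuadraticForm K V)
    (hm : ∀ (i : ℕ) (hi : i ≤ n),
      leadingPrincipalMinor (QuadraticForm.toMatrix b q) i hi ≠ 0) :
    q.Equivalent (QuadraticMap.weightedSumSquares K fun i : Fin n =>
      leadingPrincipalMinor (QuadraticForm.toMatrix b q) (i + 1) i.isLt /
        leadingPrincipalMinor (QuadraticForm.toMatrix b q) i i.isLt.le) := by
  have hsymm : (QuadraticForm.toMatrix b q).IsSymm := by
    ext i j
    rw [Matrix.transpose_apply, toMatrix_apply_eq_associated, toMatrix_apply_eq_associated]
    exact QuadraticMap.associated_isSymm K q _ _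
  obtain ⟨U, hU, hdiag⟩ := exists_transpose_mul_mul_eq_diagonal _ hsymm hm
  let f := U.toLinearEquiv b (by simp [hU])
  let v := b.map f
  have hgram : ∀ i j, QuadraticMap.associated (R := K) q (v i) (v j) =
      (U.transpose * QuadraticForm.toMatrix b q * U) i j := by
    intro i j
    have := QuadraticForm.toMatrix_comp b b q (Matrix.toLin b b U)
    rw [LinearMap.toMatrix_toLin] at this
    rw [← this, toMatrix_apply_eq_associated, QuadraticMap.associated_comp]
    rfl
  have hv : (QuadraticMap.associated (R := K) q).IsOrthoᵢ v := fun i j hij => by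
    change QuadraticMap.associated (R := K) q (v i) (v j) = 0
    rw [hgram, hdiag, Matrix.diagonal_apply_ne _ hij]
  refine ⟨?_⟩
  have e := q.isometryEquivBasisRepr v
  rw [QuadraticMap.basisRepr_eq_of_iIsOrtho q v hv] at e
  have hw : (fun i => q (v i)) = fun i : Fin n =>
      leadingPrincipalMinor (QuadraticForm.toMatrix b q) (i + 1) i.isLt /
        leadingPrincipalMinor (QuadraticForm.toMatrix b q) i i.isLt.le := by
    ext i
    rw [← QuadraticMap.associated_eq_self_apply K q, hgram, hdiag, Matrix.diagonal_apply_eq]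
  exact hw ▸ e

/-! ### From diagonal forms to the two formulas. -/

theorem evenCliffordClassEq_of_equivalent {K L V : Type u} [Field K] [Invertible (2 : K)] [Field L]
    [Algebra K L] [AddCommGroup V] [Module K V] (q : QuadraticForm K V)
    (b : Module.Basis (Fin 6) K V) (hL : IsNontrivialDiscriminantExtension L b q) (a : Fin 6 → K)
    (h : q.Equivalent (QuadraticMap.weightedSumSquares K a)) :
    (∀ i, a i ≠ 0) ∧
    EvenCliffordClassEq q
      (algebraMap K L (-(a 0 * a 1))) (algebraMap K L (-(a 0 * a 2)))
      (algebraMap K L (a 0 * a 1 * a 2 * a 3)) (algebraMap K L (a 0 * a 1 * a 2 * a 4)) := by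
  obtain ⟨f⟩ := h
  obtain ⟨hsq, δ, hδ, htop⟩ := hL
  let v : Module.Basis (Fin 6) K V := (Pi.basisFun K (Fin 6)).map f.symm.toLinearEquiv
  have hv : ∀ i, f (v i) = Pi.single i 1 := fun i => by simp [v]
  have hqv : ∀ i, q (v i) = a i := fun i => by
    rw [← f.map_app, hv, QuadraticMap.weightedSumSquares_apply,
      Finset.sum_eq_single i (by simp +contextual) (by simp)]
    simp
  have hortho : (QuadraticMap.associated (R := K) q).IsOrthoᵢ v := fun i j hij => by
    refine QuadraticMap.associated_isOrtho.2 ?_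
    rw [QuadraticMap.isOrtho_def, ← f.map_app, ← f.map_app (v i), ← f.map_app (v j), map_add,
      hv, hv]
    simp only [QuadraticMap.weightedSumSquares_apply, ← Finset.sum_add_distrib, ← smul_add]
    refine Finset.sum_congr rfl fun k _ => ?_
    congr 1
    rcases eq_or_ne k i with rfl | hk
    · simp [hij]
    · simp [hk]
  have hgram : QuadraticForm.toMatrix v q = Matrix.diagonal a := by
    ext i j
    rw [toMatrix_apply_eq_associated]
    rcases eq_or_ne i j with rfl | hij
    · rw [QuadraticMap.associated_eq_self_apply K q, hqv, Matrix.diagonal_apply_eq]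
    · rw [Matrix.diagonal_apply_ne _ hij]
      exact hortho hij
  let s := (LinearMap.toMatrix b v LinearMap.id).det
  have hΔ : signedDiscriminant b q = s * s * -(a 0 * a 1 * a 2 * a 3 * a 4 * a 5) := by
    have := QuadraticForm.discr_comp (b := b) v q LinearMap.id
    rw [show q.comp LinearMap.id = q from rfl,
      show QuadraticForm.discr v q = (QuadraticForm.toMatrix v q).det from rfl, hgram, Matrix.det_diagonal,
      Fin.prod_univ_six] at this
    rw [signedDiscriminant, this]
    norm_num [s]
  -- A zero coefficient would give `Δ = 0`, which is a square.
  have hne : ∀ i, a i ≠ 0 := by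
    intro i hi
    refine hsq ⟨0, ?_⟩
    rw [hΔ]
    fin_cases i <;> simp_all
  refine ⟨hne, ?_⟩
  simp only [← hqv] at hΔ hne ⊢
  exact evenCliffordClassEq_of_isOrtho v hortho hne hΔ hsq hδ htop

theorem HasBrauerClass.of_algEquiv {F A B : Type u} [Field F] [Ring A] [Algebra F A] [Ring B]
    [Algebra F B] (e : A ≃ₐ[F] B) {β : BrauerGroup.{u, u} F} (h : HasBrauerClass F A β) :
    HasBrauerClass F B β := by
  obtain ⟨C, ⟨f⟩, hC⟩ := h
  exact ⟨C, ⟨e.symm.trans f⟩, hC⟩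

/-- The class `(a, b) ⊗ (c, d)` is also `(a, -ab) ⊗ (c, -cd)`. -/
theorem EvenCliffordClassEq.neg_mul {K V L : Type u} [Field K] [AddCommGroup V] [Module K V]
    [Field L] [Algebra K L] {q : QuadraticForm K V} {α β γ δ : L} (hα : α ≠ 0) (hγ : γ ≠ 0)
    (h : EvenCliffordClassEq q α β γ δ) :
    EvenCliffordClassEq q α (-(α * β)) γ (-(γ * δ)) := by
  refine ⟨h.1, fun φ => ?_⟩
  obtain ⟨c₀, h₁, h₂⟩ := h.2 φ
  obtain ⟨e⟩ := QuaternionAlgebra.nonempty_algEquiv_neg_mul (b := β) hα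
  obtain ⟨e'⟩ := QuaternionAlgebra.nonempty_algEquiv_neg_mul (b := δ) hγ
  exact ⟨c₀, h₁, h₂.of_algEquiv (Algebra.TensorProduct.congr e e')⟩

theorem mainTheorem11 {K L V : Type u} [Field K] [Invertible (2 : K)] [Field L] [Algebra K L]
    [AddCommGroup V] [Module K V] (q : QuadraticForm K V) (b : Module.Basis (Fin 6) K V)
    (hq : q.Nondegenerate) (hL : IsNontrivialDiscriminantExtension L b q) :
    (∀ a₁ a₂ a₃ a₄ a₅ a₆ : K,
      QuadraticMap.Equivalent q
        (QuadraticMap.weightedSumSquares K ![a₁, a₂, a₃, a₄, a₅, a₆]) →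
      EvenCliffordClassEq q
        (algebraMap K L (-(a₁ * a₂))) (algebraMap K L (-(a₁ * a₃)))
        (algebraMap K L (a₁ * a₂ * a₃ * a₄)) (algebraMap K L (a₁ * a₂ * a₃ * a₅))) ∧
    (∀ m : ℕ → K,
      (∀ (i : ℕ) (hi : i ≤ 6), m i = leadingPrincipalMinor (QuadraticForm.toMatrix b q) i hi) →
      m 1 ≠ 0 → m 2 ≠ 0 → m 3 ≠ 0 → m 4 ≠ 0 → m 5 ≠ 0 →
      EvenCliffordClassEq q
        (algebraMap K L (-m 2)) (algebraMap K L (-(m 1 * m 3)))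
        (algebraMap K L (m 4)) (algebraMap K L (-(m 3 * m 5)))) := by
  refine ⟨fun a₁ a₂ a₃ a₄ a₅ a₆ h => (evenCliffordClassEq_of_equivalent q b hL _ h).2,
    fun m hm h1 h2 h3 h4 h5 => ?_⟩
  have h0 : m 0 = 1 := by rw [hm 0 (by norm_num)]; simp [leadingPrincipalMinor]
  have h6 : m 6 ≠ 0 := by
    rw [hm 6 le_rfl]
    intro h
    refine hL.not_isSquare ⟨0, ?_⟩
    have : QuadraticForm.discr b q = 0 := h
    simp [signedDiscriminant, this]
  have hne : ∀ (i : ℕ) (hi : i ≤ 6),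
      leadingPrincipalMinor (QuadraticForm.toMatrix b q) i hi ≠ 0 := by
    intro i hi
    rw [← hm i hi]
    interval_cases i
    · simp [h0]
    all_goals assumption
  have h := equivalent_weightedSumSquares_of_leadingPrincipalMinor b q hne
  simp only [← hm] at h
  obtain ⟨hne', hcl⟩ := evenCliffordClassEq_of_equivalent q b hL _ h
  -- With `a i = m (i+1) / m i` and `m 0 = 1`, the slots are `-m 2`, `-m 1 m 3 / m 2`, `m 4`, `m 3 m
  -- 5 / m 4`; replacing `β` by `-αβ` in each factor removes the quotients.
  have := hcl.neg_mul
    ((map_ne_zero _).2 (neg_ne_zero.2 (mul_ne_zero (hne' 0) (hne' 1))))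
    ((map_ne_zero _).2 (mul_ne_zero (mul_ne_zero (mul_ne_zero (hne' 0) (hne' 1)) (hne' 2))
      (hne' 3)))
  simp only [← map_mul, ← map_neg] at this
  convert this using 2
  all_goals
    simp [h0]
    try field_simp
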